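/- For an integer $m\ge 1$ let $\mathbb{R}\mathrm{P}^m=S^m/(x\sim -x)$. A continuous map $b\colon S^m\times S^m\to S^n$ is called symmetric $\mathbb{Z}_2$-biequivariant if $b(-x,y)=-b(x,y)=b(x,-y)$ and $b(x,y)=b(y,x)$ for all $x,y\in S^m$. Define the following numbers. - $\operatorname{sb}(m)$ is the smallest positive integer $n$ for which there is a symmetric $\mathbb{Z}_2$-biequivariant map $S^m\times S^m\to S^n$. - $\overline{\operatorname{sb}}(m)$ is the smallest positive integer $n$ for which there is a symmetric $\mathbb{Z}_2$-biequivariant map $b\colon S^m\times S^m\to S^n$ such that, for some $n$-dimensional linear subspace $H\subset\mathbb{R}^{n+1}$, $b(x,x)\notin H$ for all $x\in S^m$. - For a space $X$, let $\mathrm{P}(X)$ be the space of paths $\gamma\colon[0,1]\to X$ with the compact-open topology, and let $e_{0,1}\colon\mathrm{P}(X)\to X\times X$, $e_{0,1}(\gamma)=(\gamma(0),\gamma(1))$. The involution $\tau$ acts by $\tau(x_1,x_2)=(x_2,x_1)$ on $X\times X$ and by $(\tau\gamma)(t)=\gamma(1-t)$ on $\mathrm{P}(X)$. - $\operatorname{TC}^\Sigma(X)$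 is the smallest positive integer $n$ for which $X\times X$ can be covered by $n+1$ open sets, each closed under $\tau$ and admitting a continuous $\tau$-equivariant section of $e_{0,1}$. - $\operatorname{TC}^S(X)$ is $1+k$, where $k\ge 0$ is the smallest integer for which $X\times X\setminus\Delta_X$, with $\Delta_X=\{(x,x)\colon x\in X\}$, can be covered by $k+1$ open sets, each closed under $\tau$ and admitting a continuous $\tau$-equivariant section of the restriction $\{\gamma\in\mathrm{P}(X)\colon\gamma(0)\ne\gamma(1)\}\to X\times X\setminus\Delta_X$ of $e_{0,1}$. - $\operatorname{Emb}(\mathbb{R}\mathrm{P}^m)$ and $\operatorname{Emb}^\infty(\mathbb{R}\mathrm{P}^m)$ are the smallest $n$ for which $\mathbb{R}\mathrm{P}^m$ admits, respectively, a topological embedding and a smooth embedding into $\mathbb{R}^n$. Then, for every $m\ge 1$, all these numbers (with $X=\mathbb{R}\mathrm{P}^m$) exist, i.e. are finite, and $$\operatorname{sb}(m)\le\overline{\operatorname{sb}}(m)=\operatorname{TC}^\Sigma(\mathbb{R}\mathrm{P}^m)\le\operatorname{TC}^S(\mathbb{R}\mathrm{P}^m)\le\operatorname{Emb}(\mathbb{R}\mathrm{P}^m)\le\operatorname{Emb}^\infty(\mathbb{R}\mathrm{P}^m).$$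 -/

import Mathlib

open scoped Manifold ContDiff

namespace SymmetricTC

/-- The least element of a set of natural numbers, with value `⊤` if the set is empty. -/
noncomputable def leastNat (S : Set ℕ) : ℕ∞ := ⨅ n ∈ S, (n : ℕ∞)

theorem leastNat_eq_coe_iff (S : Set ℕ) (k : ℕ) : leastNat S = k ↔ IsLeast S k := by
  have key : ∀ j : ℕ, IsLeast S j → leastNat S = j := fun j hj =>
    le_antisymm (iInf₂_le j hj.1) (le_iInf₂ fun n hn => Nat.cast_le.mpr (hj.2 hn))
  refine ⟨fun h => ?_, key k⟩
  rcases S.eq_empty_or_nonempty with rfl | hS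
  · simp [leastNat] at h
  · have hs : IsLeast S (sInf S) := ⟨Nat.sInf_mem hS, fun n hn => Nat.sInf_le hn⟩
    have := (key _ hs).symm.trans h
    rwa [Nat.cast_inj.mp this] at hs

/-! ### Spheres, real projective spaces and symmetric biequivariant maps -/

/-- The unit sphere `S^m` of `ℝ^(m+1)`. -/
abbrev Sph (m : ℕ) : Type := Metric.sphere (0 : EuclideanSpace ℝ (Fin (m + 1))) 1

/-- The antipodal equivalence relation on `S^m`. -/
def antipodalSetoid (m : ℕ) : Setoid (Sph m) where
  r x y := x = y ∨ x = -y
  iseqv :=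
    { refl := fun _ => Or.inl rfl
      symm := by
        rintro x y (rfl | rfl)
        · exact Or.inl rfl
        · exact Or.inr (neg_neg y).symm
      trans := by
        rintro x y z (rfl | rfl) (rfl | rfl)
        · exact Or.inl rfl
        · exact Or.inr rfl
        · exact Or.inr rfl
        · exact Or.inl (neg_neg z) }

/-- The real projective space `ℝP^m`: the quotient of `S^m` by the antipodal map. -/
def RP (m : ℕ) : Type := Quotient (antipodalSetoid m)

/-- The double covering `S^m → ℝP^m`. -/
def RP.mk (m : ℕ) (x : Sph m) : RP m := Quotient.mk (antipodalSetoid m) x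

/-- The quotient topology. -/
instance (m : ℕ) : TopologicalSpace (RP m) :=
  inferInstanceAs (TopologicalSpace (Quotient (antipodalSetoid m)))

/-- Symmetric `ℤ₂`-biequivariant maps `S^m × S^m → S^n`. -/
structure IsSymmBiequivariant {m n : ℕ} (b : Sph m × Sph m → Sph n) : Prop where
  continuous : Continuous b
  neg_left : ∀ x y, b (-x, y) = -b (x, y)
  neg_right : ∀ x y, b (x, -y) = -b (x, y)
  symm : ∀ x y, b (x, y) = b (y, x)

/-- `sb(m)`: the least positive `n` for which there is a symmetric `ℤ₂`-biequivariant map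
`S^m × S^m → S^n`. -/
noncomputable def sb (m : ℕ) : ℕ∞ :=
  leastNat {n | 0 < n ∧ ∃ b : Sph m × Sph m → Sph n, IsSymmBiequivariant b}

/-- The least positive `n` for which there is a symmetric `ℤ₂`-biequivariant map
`S^m × S^m → S^n` such that the image of the diagonal does not meet some `n`-dimensional linear
subspace of `ℝ^(n+1)`. -/
noncomputable def sbBar (m : ℕ) : ℕ∞ :=
  leastNat {n | 0 < n ∧ ∃ b : Sph m × Sph m → Sph n, IsSymmBiequivariant b ∧
    ∃ H : Submodule ℝ (EuclideanSpace ℝ (Fin (n + 1))), Module.finrank ℝ H = n ∧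
      ∀ x : Sph m, (b (x, x) : EuclideanSpace ℝ (Fin (n + 1))) ∉ H}

/-! ### Equivariant sectional category for involutions -/

section Secat

variable {E B : Type*} [TopologicalSpace E] [TopologicalSpace B]

/-- `p : E → B` has a continuous section over `U ⊆ B` which commutes with the given
involutions `τE` of `E` and `τB` of `B` (for `U` closed under `τB`). -/
def HasEquivariantSection (τE : E → E) (τB : B → B) (p : E → B) (U : Set B) : Prop :=
  ∃ s : U → E, Continuous s ∧ (∀ u : U, p (s u) = u) ∧
    ∀ u v : U, (v : B) = τB u → s v = τE (s u)

/-- `B` is covered by `k` open sets, each closed under `τB` and carrying a continuous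
equivariant section of `p`. -/
def HasEquivariantSectionalCover (τE : E → E) (τB : B → B) (p : E → B) (k : ℕ) : Prop :=
  ∃ U : Fin k → Set B,
    (∀ i, IsOpen (U i) ∧ Set.MapsTo τB (U i) (U i) ∧ HasEquivariantSection τE τB p (U i)) ∧
    ⋃ i, U i = Set.univ

/-- The (reduced) equivariant sectional category: the least `n ≥ 0` such that `n + 1` open
sets suffice. -/
noncomputable def equivariantSecat (τE : E → E) (τB : B → B) (p : E → B) : ℕ∞ :=
  leastNat {n | HasEquivariantSectionalCover τE τB p (n + 1)}

end Secat

/-! ### Path spaces and the two topological complexities -/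

section TC

variable (X : Type*) [TopologicalSpace X]

/-- The free path space `P(X)`, with the compact-open topology. -/
abbrev PathSp : Type _ := C(unitInterval, X)

variable {X}

/-- Reversal of paths, `(τ γ)(t) = γ (1 - t)`. -/
def PathSp.reverse (γ : PathSp X) : PathSp X :=
  γ.comp ⟨unitInterval.symm, unitInterval.continuous_symm⟩

/-- The double evaluation map `e_{0,1} : P(X) → X × X`. -/
def doubleEval (γ : PathSp X) : X × X := (γ 0, γ 1)

variable (X)

/-- The space `P^op(X)` of open paths (those whose two endpoints are different). -/
abbrev OpenPathSp : Type _ := {γ : PathSp X // γ 0 ≠ γ 1}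

/-- The complement of the diagonal in `X × X`. -/
abbrev OffDiag : Type _ := {p : X × X // p.1 ≠ p.2}

variable {X}

def OpenPathSp.reverse (γ : OpenPathSp X) : OpenPathSp X :=
  ⟨PathSp.reverse γ.1, by simpa [PathSp.reverse] using γ.2.symm⟩

def OffDiag.swap (p : OffDiag X) : OffDiag X := ⟨p.1.swap, p.2.symm⟩

/-- The restriction `ε_{0,1} : P^op(X) → X × X - Δ_X` of the double evaluation map. -/
def openDoubleEval (γ : OpenPathSp X) : OffDiag X := ⟨doubleEval γ.1, γ.2⟩

variable (X)

/-- The symmetrized topological complexity `TC^Σ(X)`: the least positive `n` such that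
`X × X` is covered by `n + 1` open sets closed under the switch and carrying a continuous
equivariant section of `e_{0,1}`. -/
noncomputable def TCSigma : ℕ∞ :=
  leastNat {n | 0 < n ∧
    HasEquivariantSectionalCover PathSp.reverse Prod.swap (doubleEval (X := X)) (n + 1)}

/-- The symmetric topological complexity `TC^S(X)`: one more than the equivariant sectional
category of `ε_{0,1} : P^op(X) → X × X - Δ_X`. -/
noncomputable def TCS : ℕ∞ :=
  equivariantSecat OpenPathSp.reverse OffDiag.swap (openDoubleEval (X := X)) + 1

end TC

/-! ### Euclidean embedding dimension -/

/-- The least `n` such that `ℝP^m` embeds topologically into `ℝ^n`. -/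
noncomputable def Emb (m : ℕ) : ℕ∞ :=
  leastNat {n | ∃ f : RP m → EuclideanSpace ℝ (Fin n), Topology.IsEmbedding f}

/-- The least `n` such that `ℝP^m` embeds smoothly into `ℝ^n`. As `S^m → ℝP^m` is a local
diffeomorphism, a map on `ℝP^m` is smooth (resp. a smooth immersion) exactly when its composite
with this covering is. -/
noncomputable def smoothEmb (m : ℕ) : ℕ∞ :=
  leastNat {n | ∃ f : RP m → EuclideanSpace ℝ (Fin n), Topology.IsEmbedding f ∧
    ContMDiff (𝓡 m) (𝓡 n) ∞ (fun x : Sph m => f (RP.mk m x)) ∧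
    ∀ x : Sph m,
      Function.Injective (mfderiv (𝓡 m) (𝓡 n) (fun x : Sph m => f (RP.mk m x)) x)}

end SymmetricTC

namespace SymmetricTC

variable {m : ℕ}

/-! ### Least elements -/

/-! Everything rests on translating motion planners into real functions. Over a switch-invariant set
of pairs of lines, an equivariant section of the path fibration yields, and is yielded by, a
continuous nonvanishing function `g` of the pairs of lifts that is symmetric, odd in each variable
and positive on the diagonal (`IsSignFunction`). From a section, lift the path from `x`: it ends at
`y` or `-y`, and `g` records the sign. Conversely, the sign of `g` selects one of `y`, `-y`, and `x`
is moved to it along the normalized segment.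

A cover by `n + 1` such sets thus corresponds to `n + 1` symmetric biodd functions without common
zero, nonnegative on the diagonal, that is, to a symmetric biequivariant map to `S^n` with a
condition on the diagonal. A partition of unity passes from covers to maps (`sbBar_le_TCSigma`). In
the other direction a coordinate system adapted to the avoided hyperplane is used
(`TCSigma_le_sbBar`).

A cover of the complement of the diagonal becomes a cover of the whole product by adding the single
set of non-orthogonal pairs of lines. An embedding in `ℝ^n` gives `n` functions off the diagonal:
compare each coordinate on the two bisectors of a pair of lines. Finiteness of the last number, by
the Veronese embedding, bounds the whole chain. -/

theorem leastNat_mono {S T : Set ℕ} (h : S ⊆ T) : leastNat T ≤ leastNat S :=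
  le_iInf₂ fun n hn => iInf₂_le n (h hn)

theorem leastNat_le {S : Set ℕ} {n : ℕ} (h : n ∈ S) : leastNat S ≤ n := iInf₂_le n h

theorem exists_mem_of_leastNat_ne_top {S : Set ℕ} (h : leastNat S ≠ ⊤) :
    ∃ k ∈ S, leastNat S = k := by
  obtain ⟨k, hk⟩ := ENat.ne_top_iff_exists.mp h
  exact ⟨k, ((leastNat_eq_coe_iff S k).mp hk.symm).1, hk.symm⟩

/-! ### The covering `S^m → ℝP^m` -/

theorem Sph.ne_neg (x : Sph m) : x ≠ -x := by
  intro h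
  have h' : (x : EuclideanSpace ℝ (Fin (m + 1))) = -x := congrArg Subtype.val h
  have h2 : (2 : ℝ) • (x : EuclideanSpace ℝ (Fin (m + 1))) = 0 := by
    rw [two_smul]
    nth_rewrite 2 [h']
    exact add_neg_cancel _
  exact Metric.ne_of_mem_sphere x.2 one_ne_zero ((smul_eq_zero.mp h2).resolve_left two_ne_zero)

theorem Sph.coe_ne_zero (x : Sph m) : (x : EuclideanSpace ℝ (Fin (m + 1))) ≠ 0 :=
  Metric.ne_of_mem_sphere x.2 one_ne_zero

theorem Sph.norm_coe (x : Sph m) : ‖(x : EuclideanSpace ℝ (Fin (m + 1)))‖ = 1 := by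
  simp

theorem RP.mk_eq_mk_iff {x y : Sph m} : RP.mk m x = RP.mk m y ↔ x = y ∨ x = -y :=
  Quotient.eq (r := antipodalSetoid m)

@[simp] theorem RP.mk_neg (x : Sph m) : RP.mk m (-x) = RP.mk m x :=
  RP.mk_eq_mk_iff.mpr (Or.inr rfl)

theorem RP.mk_surjective : Function.Surjective (RP.mk m) := Quotient.mk_surjective

/-- The antipodal action of `{±1}` on the sphere. -/
@[reducible] noncomputable def antipodalAction (m : ℕ) : MulAction ℤˣ (Sph m) where
  smul u x := if u = 1 then x else -x
  one_smul x := if_pos rfl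
  mul_smul u v x := by
    change (if u * v = 1 then x else -x) =
      if u = 1 then (if v = 1 then x else -x) else -(if v = 1 then x else -x)
    rcases Int.units_eq_one_or u with rfl | rfl <;> rcases Int.units_eq_one_or v with rfl | rfl <;>
      simp

theorem RP.isQuotientMap_mk : Topology.IsQuotientMap (RP.mk m) := isQuotientMap_quot_mk

theorem RP.isQuotientCoveringMap :
    let _ := antipodalAction m
    IsQuotientCoveringMap (RP.mk m) ℤˣ := by
  let _ := antipodalAction m
  have hone : ∀ x : Sph m, (1 : ℤˣ) • x = x := one_smul _
  have hneg : ∀ x : Sph m, (-1 : ℤˣ) • x = -x := fun x => if_neg (by decide)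
  refine { RP.isQuotientMap_mk with
    continuous_const_smul := fun u => ?_
    apply_eq_iff_mem_orbit := fun {x y} => ?_
    -- Antipodes are at distance 2, so a ball of radius 1 is disjoint from its antipode.
    disjoint := fun x => ⟨Metric.ball x 1, Metric.ball_mem_nhds x one_pos, fun u => ?_⟩ }
  · rcases Int.units_eq_one_or u with rfl | rfl
    · simpa only [hone] using continuous_id'
    · simpa only [hneg] using continuous_neg
  · rw [RP.mk_eq_mk_iff]
    constructor
    · rintro (rfl | rfl)
      · exact ⟨1, hone _⟩
      · exact ⟨-1, hneg _⟩
    · rintro ⟨u, hu⟩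
      rcases Int.units_eq_one_or u with rfl | rfl
      · exact Or.inl ((hone y).symm.trans hu).symm
      · exact Or.inr ((hneg y).symm.trans hu).symm
  · rcases Int.units_eq_one_or u with rfl | rfl
    · exact fun _ => rfl
    · rintro ⟨_, ⟨y, hy, rfl⟩, hy'⟩
      exfalso
      simp only [hneg, Metric.mem_ball] at hy hy'
      have h2 : dist (-y) y = 2 := by
        rw [Subtype.dist_eq, dist_eq_norm]
        change ‖-(y : EuclideanSpace ℝ (Fin (m + 1))) - y‖ = 2
        rw [← neg_add', norm_neg, ← two_smul ℝ, norm_smul, Sph.norm_coe]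
        norm_num
      linarith [dist_triangle_right (-y) y x]

theorem RP.isCoveringMap_mk : IsCoveringMap (RP.mk m) :=
  let _ := antipodalAction m
  RP.isQuotientCoveringMap.isCoveringMap

theorem RP.isOpenQuotientMap_mk : IsOpenQuotientMap (RP.mk m) :=
  let _ := antipodalAction m
  RP.isQuotientCoveringMap.isOpenQuotientMap

theorem RP.continuous_mk : Continuous (RP.mk m) := RP.isOpenQuotientMap_mk.continuous

instance : CompactSpace (RP m) := inferInstanceAs (CompactSpace (Quotient (antipodalSetoid m)))

instance : T2Space (RP m) := by
  rw [t2Space_iff_of_isOpenQuotientMap RP.isOpenQuotientMap_mk]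
  have : {q : Sph m × Sph m | RP.mk m q.1 = RP.mk m q.2} =
      {q | q.1 = q.2} ∪ {q | q.1 = -q.2} := by
    ext q
    exact RP.mk_eq_mk_iff
  rw [this]
  exact (isClosed_eq continuous_fst continuous_snd).union
    (isClosed_eq continuous_fst continuous_snd.neg)

/-- The covering `S^m × S^m → ℝP^m × ℝP^m`. -/
def RP.mk₂ (m : ℕ) : Sph m × Sph m → RP m × RP m := Prod.map (RP.mk m) (RP.mk m)

theorem RP.isOpenQuotientMap_mk₂ : IsOpenQuotientMap (RP.mk₂ m) :=
  RP.isOpenQuotientMap_mk.prodMap RP.isOpenQuotientMap_mk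

/-- The line spanned by a nonzero vector, as a point of `ℝP^m`. -/
noncomputable def RP.ofVec (v : {v : EuclideanSpace ℝ (Fin (m + 1)) // v ≠ 0}) : RP m :=
  RP.mk m ⟨‖v.1‖⁻¹ • v.1, by simp [norm_smul, v.2]⟩

theorem RP.continuous_ofVec : Continuous (RP.ofVec (m := m)) := by
  refine RP.continuous_mk.comp (Continuous.subtype_mk ?_ _)
  exact (continuous_subtype_val.norm.inv₀ fun v => norm_ne_zero_iff.mpr v.2).smul
    continuous_subtype_val

theorem RP.ofVec_eq_mk {v : EuclideanSpace ℝ (Fin (m + 1))} (hv : v ≠ 0) {x : Sph m} {c : ℝ}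
    (h : v = c • (x : EuclideanSpace ℝ (Fin (m + 1)))) : RP.ofVec ⟨v, hv⟩ = RP.mk m x := by
  subst h
  have hc : c ≠ 0 := fun h => hv (by simp [h])
  refine RP.mk_eq_mk_iff.mpr ?_
  have key : ‖c • (x : EuclideanSpace ℝ (Fin (m + 1)))‖⁻¹ • c •
      (x : EuclideanSpace ℝ (Fin (m + 1))) = (|c|⁻¹ * c) • x := by
    rw [norm_smul, Sph.norm_coe, mul_one, smul_smul, Real.norm_eq_abs]
  rcases lt_or_gt_of_ne hc with h | h
  · right
    apply Subtype.ext
    refine key.trans ?_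
    rw [abs_of_neg h, inv_neg, neg_mul, inv_mul_cancel₀ hc]
    simp
  · left
    apply Subtype.ext
    refine key.trans ?_
    rw [abs_of_pos h, inv_mul_cancel₀ hc, one_smul]

theorem RP.ofVec_eq_ofVec {v w : EuclideanSpace ℝ (Fin (m + 1))} (hv : v ≠ 0) (hw : w ≠ 0) {c : ℝ}
    (h : v = c • w) : RP.ofVec ⟨v, hv⟩ = RP.ofVec ⟨w, hw⟩ := by
  refine RP.ofVec_eq_mk hv (c := c * ‖w‖) ?_
  rw [h, smul_smul, mul_assoc, mul_inv_cancel₀ (norm_ne_zero_iff.mpr hw), mul_one]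

theorem RP.exists_smul_eq_of_ofVec_eq {v w : EuclideanSpace ℝ (Fin (m + 1))} (hv : v ≠ 0)
    (hw : w ≠ 0) (h : RP.ofVec ⟨v, hv⟩ = RP.ofVec ⟨w, hw⟩) : ∃ c : ℝ, v = c • w := by
  have hv' : ‖v‖ ≠ 0 := norm_ne_zero_iff.mpr hv
  rcases RP.mk_eq_mk_iff.mp h with h | h
  · have h' : ‖v‖⁻¹ • v = ‖w‖⁻¹ • w := congrArg Subtype.val h
    exact ⟨‖v‖ * ‖w‖⁻¹, by rw [mul_smul, ← h', smul_smul, mul_inv_cancel₀ hv', one_smul]⟩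
  · have h' : ‖v‖⁻¹ • v = -(‖w‖⁻¹ • w) := congrArg Subtype.val h
    exact ⟨-(‖v‖ * ‖w‖⁻¹), by
      rw [neg_smul, mul_smul, ← smul_neg, ← h', smul_smul, mul_inv_cancel₀ hv', one_smul]⟩

/-! ### Equivariant sections over subsets of `ℝP^m × ℝP^m` -/

theorem PathSp.reverse_apply {X : Type*} [TopologicalSpace X] (γ : PathSp X) (t : unitInterval) :
    PathSp.reverse γ t = γ (unitInterval.symm t) := rfl

/-- A continuous choice of relative signs for the lifts of the pairs of lines in `U`, symmetric
and positive on the diagonal. -/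
structure IsSignFunction (U : Set (RP m × RP m)) (g : Sph m × Sph m → ℝ) : Prop where
  continuousOn : ContinuousOn g (RP.mk₂ m ⁻¹' U)
  ne_zero : ∀ x y, RP.mk₂ m (x, y) ∈ U → g (x, y) ≠ 0
  neg_left : ∀ x y, RP.mk₂ m (x, y) ∈ U → g (-x, y) = -g (x, y)
  neg_right : ∀ x y, RP.mk₂ m (x, y) ∈ U → g (x, -y) = -g (x, y)
  symm : ∀ x y, RP.mk₂ m (x, y) ∈ U → g (x, y) = g (y, x)
  diag_pos : ∀ x, RP.mk₂ m (x, x) ∈ U → 0 < g (x, x)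

theorem RP.mk₂_neg_left (x y : Sph m) : RP.mk₂ m (-x, y) = RP.mk₂ m (x, y) := by
  simp [RP.mk₂]

theorem RP.mk₂_neg_right (x y : Sph m) : RP.mk₂ m (x, -y) = RP.mk₂ m (x, y) := by
  simp [RP.mk₂]

theorem RP.mk₂_swap (x y : Sph m) : RP.mk₂ m (y, x) = (RP.mk₂ m (x, y)).swap := rfl

theorem RP.mk₂_eq_mk₂ {x y x' y' : Sph m} (h : RP.mk₂ m (x, y) = RP.mk₂ m (x', y')) :
    (x = x' ∨ x = -x') ∧ (y = y' ∨ y = -y') :=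
  ⟨RP.mk_eq_mk_iff.mp (congrArg Prod.fst h), RP.mk_eq_mk_iff.mp (congrArg Prod.snd h)⟩

/-- A vector moving from the line of `x` to the line of `y`. -/
noncomputable def rotationVec (g : Sph m × Sph m → ℝ) (t : ℝ) (p : Sph m × Sph m) :
    EuclideanSpace ℝ (Fin (m + 1)) :=
  ((1 - t) * |g p|) • (p.1 : EuclideanSpace ℝ (Fin (m + 1))) +
    (t * g p) • (p.2 : EuclideanSpace ℝ (Fin (m + 1)))

/-- If the vector vanishes, comparing norms forces `t = 1/2`, and then `x` is antipodal to the
chosen lift of the second line. The two lines coincide, and positivity on the diagonal excludes this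
sign. -/
theorem IsSignFunction.rotationVec_ne_zero {U : Set (RP m × RP m)} {g : Sph m × Sph m → ℝ}
    (hg : IsSignFunction U g) (t : unitInterval) {p : Sph m × Sph m} (hp : RP.mk₂ m p ∈ U) :
    rotationVec g t p ≠ 0 := by
  obtain ⟨x, y⟩ := p
  intro h
  have hne := hg.ne_zero x y hp
  have h1 : ((1 - (t : ℝ)) * |g (x, y)|) • (x : EuclideanSpace ℝ (Fin (m + 1))) =
      (-(t * g (x, y))) • (y : EuclideanSpace ℝ (Fin (m + 1))) := by
    rw [neg_smul]
    exact eq_neg_of_add_eq_zero_left h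
  have h2 := congrArg norm h1
  rw [norm_smul, norm_smul, Sph.norm_coe, Sph.norm_coe, mul_one, mul_one, norm_neg, norm_mul,
    norm_mul, Real.norm_eq_abs, Real.norm_eq_abs, Real.norm_eq_abs, Real.norm_eq_abs, abs_abs,
    abs_of_nonneg (sub_nonneg.mpr t.2.2), abs_of_nonneg t.2.1] at h2
  have ht : 1 - (t : ℝ) = t := mul_right_cancel₀ (abs_ne_zero.mpr hne) h2
  have ht0 : (t : ℝ) ≠ 0 := fun h0 => by rw [h0] at ht; norm_num at ht
  rw [ht] at h1
  rcases lt_or_gt_of_ne hne with hlt | hlt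
  · rw [abs_of_neg hlt, mul_neg] at h1
    have hxy : x = y := Subtype.ext (smul_right_injective _ (neg_ne_zero.mpr
      (mul_ne_zero ht0 hne)) h1)
    subst hxy
    exact lt_asymm hlt (hg.diag_pos x hp)
  · rw [abs_of_pos hlt, neg_smul, ← smul_neg] at h1
    have hxy : x = -y := Subtype.ext (smul_right_injective _ (mul_ne_zero ht0 hne) h1)
    subst hxy
    rw [RP.mk₂_neg_left] at hp
    have := hg.diag_pos y hp
    rw [hg.neg_left y y hp] at hlt
    linarith

/-- Changing the sign of `x` or `y` rescales `rotationVec` by `1` or `-1`, so the path of lines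
depends only on the pair of lines. Continuity descends because the covering is an open quotient map.
-/
theorem IsSignFunction.hasEquivariantSection {U : Set (RP m × RP m)} {g : Sph m × Sph m → ℝ}
    (hg : IsSignFunction U g) :
    HasEquivariantSection PathSp.reverse Prod.swap (doubleEval (X := RP m)) U := by
  let A := RP.mk₂ m ⁻¹' U
  have hgA : Continuous fun a : A => g a := continuousOn_iff_continuous_domRestrict.mp hg.continuousOn
  have hx : Continuous fun a : A × unitInterval =>
      ((a.1 : Sph m × Sph m).1 : EuclideanSpace ℝ (Fin (m + 1))) := by fun_prop
  have hy : Continuous fun a : A × unitInterval =>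
      ((a.1 : Sph m × Sph m).2 : EuclideanSpace ℝ (Fin (m + 1))) := by fun_prop
  have ht : Continuous fun a : A × unitInterval => (a.2 : ℝ) := by fun_prop
  have hg1 : Continuous fun a : A × unitInterval => g a.1 := hgA.comp continuous_fst
  have hw : Continuous fun a : A × unitInterval => rotationVec g a.2 (a.1 : Sph m × Sph m) :=
    (((continuous_const.sub ht).mul hg1.abs).smul hx).add ((ht.mul hg1).smul hy)
  let F : C(A × unitInterval, RP m) :=
    ⟨fun a => RP.ofVec ⟨rotationVec g a.2 (a.1 : Sph m × Sph m), hg.rotationVec_ne_zero a.2 a.1.2⟩,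
      RP.continuous_ofVec.comp (hw.subtype_mk _)⟩
  have hF : ∀ (a : A) t, F.curry a t =
      RP.ofVec ⟨rotationVec g t (a : Sph m × Sph m), hg.rotationVec_ne_zero t a.2⟩ := fun _ _ => rfl
  have hr := RP.isOpenQuotientMap_mk₂.restrictPreimage (f := RP.mk₂ m) U
  set r : A → U := U.restrictPreimage (RP.mk₂ m) with hrdef
  have hinv : ∀ a b : A, r a = r b → F.curry a = F.curry b := by
    rintro ⟨⟨x, y⟩, ha⟩ ⟨⟨x', y'⟩, hb⟩ hab
    have hb' : RP.mk₂ m (x', y') ∈ U := hb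
    obtain ⟨hx | hx, hy | hy⟩ := RP.mk₂_eq_mk₂ (congrArg Subtype.val hab) <;> subst hx <;> subst hy
    · rfl
    · ext t
      rw [hF, hF]
      refine RP.ofVec_eq_ofVec _ _ (c := 1) ?_
      simp [rotationVec, hg.neg_right _ _ hb']
    · ext t
      rw [hF, hF]
      refine RP.ofVec_eq_ofVec _ _ (c := -1) ?_
      simp [rotationVec, hg.neg_left _ _ hb']
    · ext t
      rw [hF, hF]
      refine RP.ofVec_eq_ofVec _ _ (c := -1) ?_
      have hb'' : RP.mk₂ m (x', -y') ∈ U := by rwa [RP.mk₂_neg_right]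
      simp [rotationVec, hg.neg_left _ _ hb'', hg.neg_right _ _ hb']
  let s : U → PathSp (RP m) := fun u => F.curry (Function.surjInv hr.surjective u)
  have hs : ∀ a, s (r a) = F.curry a := fun a => hinv _ _ (Function.surjInv_eq hr.surjective _)
  refine ⟨s, hr.continuous_comp_iff.mp ?_, fun u => ?_, fun u v huv => ?_⟩
  · rw [show s ∘ r = F.curry from funext hs]
    exact F.curry.continuous
  · obtain ⟨⟨⟨x, y⟩, ha⟩, rfl⟩ := hr.surjective u
    rw [hs]
    refine Prod.ext ?_ ?_
    · change F.curry _ 0 = RP.mk m x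
      rw [hF]
      exact RP.ofVec_eq_mk _ (c := |g (x, y)|) (by simp [rotationVec])
    · change F.curry _ 1 = RP.mk m y
      rw [hF]
      exact RP.ofVec_eq_mk _ (c := g (x, y)) (by simp [rotationVec])
  · obtain ⟨⟨⟨x, y⟩, ha⟩, rfl⟩ := hr.surjective u
    have ha' : RP.mk₂ m (x, y) ∈ U := ha
    have hb' : RP.mk₂ m (y, x) ∈ U := by
      have := v.2
      rwa [huv] at this
    obtain rfl : v = r ⟨(y, x), hb'⟩ := Subtype.ext huv
    rw [hs, hs]
    ext t
    rw [PathSp.reverse_apply, hF, hF]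
    -- Interchanging the endpoints and reversing time multiplies the vector by the sign of `g`.
    refine RP.ofVec_eq_ofVec _ _ (c := g (x, y) / |g (x, y)|) ?_
    have h0 : |g (x, y)| ≠ 0 := abs_ne_zero.mpr (hg.ne_zero x y ha')
    simp only [rotationVec, smul_add, smul_smul, unitInterval.coe_symm_eq, sub_sub_cancel,
      hg.symm y x hb']
    refine (add_comm _ _).trans (congrArg₂ _ (congrArg (· • _) ?_) (congrArg (· • _) ?_))
    · field_simp
    · field_simp
      rw [sq_abs]

/-- The point `z` is the end of the lift of `γ` to the sphere starting at `x`. -/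
def IsLiftEnd (γ : PathSp (RP m)) (x z : Sph m) : Prop :=
  ∃ Γ : PathSp (Sph m), (∀ t, RP.mk m (Γ t) = γ t) ∧ Γ 0 = x ∧ Γ 1 = z

theorem eq_of_lifts {γ : PathSp (RP m)} {Γ Γ' : PathSp (Sph m)} (h : ∀ t, RP.mk m (Γ t) = γ t)
    (h' : ∀ t, RP.mk m (Γ' t) = γ t) (h0 : Γ 0 = Γ' 0) : Γ = Γ' :=
  DFunLike.coe_injective (RP.isCoveringMap_mk.eq_of_comp_eq Γ.continuous Γ'.continuous
    (funext fun t => (h t).trans (h' t).symm) 0 h0)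

namespace IsLiftEnd

variable {γ : PathSp (RP m)} {x z z' : Sph m}

theorem unique (h : IsLiftEnd γ x z) (h' : IsLiftEnd γ x z') : z = z' := by
  obtain ⟨Γ, hΓ, h0, h1⟩ := h
  obtain ⟨Γ', hΓ', h0', h1'⟩ := h'
  rw [← h1, ← h1', eq_of_lifts hΓ hΓ' (h0.trans h0'.symm)]

theorem neg (h : IsLiftEnd γ x z) : IsLiftEnd γ (-x) (-z) := by
  obtain ⟨Γ, hΓ, h0, h1⟩ := h
  exact ⟨⟨fun t => -Γ t, by fun_prop⟩, fun t => (RP.mk_neg _).trans (hΓ t), congrArg Neg.neg h0,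
    congrArg Neg.neg h1⟩

theorem reverse (h : IsLiftEnd γ x z) : IsLiftEnd (PathSp.reverse γ) z x := by
  obtain ⟨Γ, hΓ, h0, h1⟩ := h
  refine ⟨PathSp.reverse Γ, fun t => hΓ _, ?_, ?_⟩
  · rw [PathSp.reverse_apply, unitInterval.symm_zero, h1]
  · rw [PathSp.reverse_apply, unitInterval.symm_one, h0]

theorem mk_right (h : IsLiftEnd γ x z) : RP.mk m z = γ 1 := by
  obtain ⟨Γ, hΓ, -, rfl⟩ := h
  exact hΓ 1

theorem mk_left (h : IsLiftEnd γ x z) : RP.mk m x = γ 0 := by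
  obtain ⟨Γ, hΓ, rfl, -⟩ := h
  exact hΓ 0

/-- A path which equals its own reverse lifts to a closed path. -/
theorem eq_of_reverse_eq (h : IsLiftEnd γ x z) (hγ : PathSp.reverse γ = γ) : z = x := by
  have h01 : γ 1 = γ 0 := by
    conv_lhs => rw [← hγ, PathSp.reverse_apply, unitInterval.symm_one]
  rcases RP.mk_eq_mk_iff.mp (h.mk_right.trans (h01.trans h.mk_left.symm)) with hz | hz
  · exact hz
  · exfalso
    obtain ⟨Γ, hΓ, h0, h1⟩ := h
    let Γ' : PathSp (Sph m) := ⟨fun t => -Γ (unitInterval.symm t), by fun_prop⟩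
    have hΓ' : ∀ t, RP.mk m (Γ' t) = γ t := fun t =>
      (RP.mk_neg _).trans ((hΓ _).trans (DFunLike.congr_fun hγ t))
    have heq : Γ = Γ' := eq_of_lifts hΓ hΓ' (by
      change Γ 0 = -Γ (unitInterval.symm 0)
      rw [unitInterval.symm_zero, h0, h1, hz, neg_neg])
    -- If the lift ended at `-x`, uniqueness of lifts would give `Γ t = -Γ (1 - t)`, which is absurd
    -- at the midpoint.
    let c : unitInterval := ⟨1 / 2, by norm_num, by norm_num⟩
    have hc : unitInterval.symm c = c := Subtype.ext (by
      rw [unitInterval.coe_symm_eq]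
      norm_num [c])
    have h2 : Γ c = -Γ (unitInterval.symm c) := DFunLike.congr_fun heq c
    rw [hc] at h2
    exact Sph.ne_neg _ h2

end IsLiftEnd

theorem inner_self_eq_one (x : Sph m) :
    inner ℝ (x : EuclideanSpace ℝ (Fin (m + 1))) (x : EuclideanSpace ℝ (Fin (m + 1))) = 1 := by
  rw [real_inner_self_eq_norm_sq, Sph.norm_coe, one_pow]

/-- All the paths are lifted simultaneously as one homotopy with initial value `x`, so the endpoint
`L` is continuous. The sign rules follow from uniqueness of lifts, and positivity on the diagonal
from `IsLiftEnd.eq_of_reverse_eq`: there equivariance makes the path its own reverse. -/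
theorem HasEquivariantSection.exists_isSignFunction {U : Set (RP m × RP m)}
    (hU : Set.MapsTo Prod.swap U U)
    (h : HasEquivariantSection PathSp.reverse Prod.swap (doubleEval (X := RP m)) U) :
    ∃ g, IsSignFunction U g := by
  obtain ⟨s, hs, hend, hswap⟩ := h
  let A := RP.mk₂ m ⁻¹' U
  let r : A → U := U.restrictPreimage (RP.mk₂ m)
  have hr : Continuous r := RP.isOpenQuotientMap_mk₂.continuous.restrictPreimage
  let F : C(A, PathSp (RP m)) := ⟨s ∘ r, hs.comp hr⟩
  let H : C(unitInterval × A, RP m) := F.uncurry.comp ContinuousMap.prodSwap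
  let f : C(A, Sph m) := ⟨fun a => (a : Sph m × Sph m).1, by fun_prop⟩
  have H0 : ∀ a, H (0, a) = RP.mk m (f a) := fun a => congrArg Prod.fst (hend (r a))
  let G := RP.isCoveringMap_mk.liftHomotopy H f H0
  let L : A → Sph m := fun a => G (1, a)
  have hL : Continuous L := by fun_prop
  have hlift : ∀ a, IsLiftEnd (s (r a)) (a : Sph m × Sph m).1 (L a) := fun a =>
    ⟨G.comp ⟨fun t => (t, a), by fun_prop⟩,
      fun t => congrFun (RP.isCoveringMap_mk.liftHomotopy_lifts H f H0) (t, a),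
      RP.isCoveringMap_mk.liftHomotopy_zero H f H0 a, rfl⟩
  have hLy : ∀ (x y : Sph m) (hp : RP.mk₂ m (x, y) ∈ U), L ⟨(x, y), hp⟩ = y ∨ L ⟨(x, y), hp⟩ = -y :=
    fun x y hp => RP.mk_eq_mk_iff.mp
      ((hlift ⟨(x, y), hp⟩).mk_right.trans (congrArg Prod.snd (hend (r ⟨(x, y), hp⟩))))
  classical
  -- As `L` is `y` or `-y`, the inner product is the sign `1` or `-1`; the value `0` outside the
  -- domain plays no role.
  let g : Sph m × Sph m → ℝ := fun p => if hp : RP.mk₂ m p ∈ U then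
    inner ℝ (L ⟨p, hp⟩ : EuclideanSpace ℝ (Fin (m + 1))) (p.2 : EuclideanSpace ℝ (Fin (m + 1)))
    else 0
  have hg : ∀ (p : Sph m × Sph m) (hp : RP.mk₂ m p ∈ U), g p =
      inner ℝ (L ⟨p, hp⟩ : EuclideanSpace ℝ (Fin (m + 1)))
        (p.2 : EuclideanSpace ℝ (Fin (m + 1))) := fun p hp => dif_pos hp
  have hg1 : ∀ (x y : Sph m) (hp : RP.mk₂ m (x, y) ∈ U), L ⟨(x, y), hp⟩ = y → g (x, y) = 1 :=
    fun x y hp h => by rw [hg _ hp, h, inner_self_eq_one]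
  have hg2 : ∀ (x y : Sph m) (hp : RP.mk₂ m (x, y) ∈ U), L ⟨(x, y), hp⟩ = -y → g (x, y) = -1 :=
    fun x y hp h => by
      rw [hg _ hp, h]
      change inner ℝ (-(y : EuclideanSpace ℝ (Fin (m + 1)))) _ = _
      rw [inner_neg_left, inner_self_eq_one]
  have hrn : ∀ (x y : Sph m) (hp : RP.mk₂ m (x, y) ∈ U) (hp' : RP.mk₂ m (-x, y) ∈ U),
      r ⟨(-x, y), hp'⟩ = r ⟨(x, y), hp⟩ := fun x y _ _ => Subtype.ext (RP.mk₂_neg_left x y)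
  have hrn' : ∀ (x y : Sph m) (hp : RP.mk₂ m (x, y) ∈ U) (hp' : RP.mk₂ m (x, -y) ∈ U),
      r ⟨(x, -y), hp'⟩ = r ⟨(x, y), hp⟩ := fun x y _ _ => Subtype.ext (RP.mk₂_neg_right x y)
  have hrs : ∀ (x y : Sph m) (hp : RP.mk₂ m (x, y) ∈ U) (hp' : RP.mk₂ m (y, x) ∈ U),
      s (r ⟨(y, x), hp'⟩) = PathSp.reverse (s (r ⟨(x, y), hp⟩)) := fun x y _ _ =>
    hswap _ _ (RP.mk₂_swap x y)
  refine ⟨g, ?_, fun x y hp => ?_, fun x y hp => ?_, fun x y hp => ?_, fun x y hp => ?_,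
    fun x hp => ?_⟩
  · rw [continuousOn_iff_continuous_domRestrict]
    have : (RP.mk₂ m ⁻¹' U).domRestrict g = fun a : A =>
        inner ℝ (L a : EuclideanSpace ℝ (Fin (m + 1)))
          ((a : Sph m × Sph m).2 : EuclideanSpace ℝ (Fin (m + 1))) := funext fun a => hg a a.2
    rw [this]
    fun_prop
  · rcases hLy x y hp with h | h
    · rw [hg1 x y hp h]
      norm_num
    · rw [hg2 x y hp h]
      norm_num
  · have hp' : RP.mk₂ m (-x, y) ∈ U := by rwa [RP.mk₂_neg_left]
    have h1 : L ⟨(-x, y), hp'⟩ = -L ⟨(x, y), hp⟩ := by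
      have := hlift ⟨(-x, y), hp'⟩
      rw [hrn x y hp hp'] at this
      exact this.unique (hlift ⟨(x, y), hp⟩).neg
    rcases hLy x y hp with h | h
    · rw [hg1 x y hp h, hg2 (-x) y hp' (by rw [h1, h])]
    · rw [hg2 x y hp h, hg1 (-x) y hp' (by rw [h1, h, neg_neg]), neg_neg]
  · have hp' : RP.mk₂ m (x, -y) ∈ U := by rwa [RP.mk₂_neg_right]
    have h1 : L ⟨(x, -y), hp'⟩ = L ⟨(x, y), hp⟩ := by
      have := hlift ⟨(x, -y), hp'⟩
      rw [hrn' x y hp hp'] at this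
      exact this.unique (hlift ⟨(x, y), hp⟩)
    rcases hLy x y hp with h | h
    · rw [hg1 x y hp h, hg2 x (-y) hp' (by rw [h1, h, neg_neg])]
    · rw [hg2 x y hp h, hg1 x (-y) hp' (by rw [h1, h]), neg_neg]
  · have hp' : RP.mk₂ m (y, x) ∈ U := hU hp
    have h0 := hlift ⟨(y, x), hp'⟩
    rw [hrs x y hp hp'] at h0
    have h1 := (hlift ⟨(x, y), hp⟩).reverse
    rcases hLy x y hp with h | h
    · rw [h] at h1
      rw [hg1 x y hp h, hg1 y x hp' (h0.unique h1)]
    · rw [h] at h1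
      have h2 := h1.neg
      rw [neg_neg] at h2
      rw [hg2 x y hp h, hg2 y x hp' (h0.unique h2)]
  · rw [hg1 x x hp ((hlift ⟨(x, x), hp⟩).eq_of_reverse_eq (hrs x x hp hp).symm)]
    exact one_pos

/-! ### Covers by the nonvanishing loci of symmetric biodd functions -/

/-- Real functions on `S^m × S^m` which are symmetric, odd in each variable, nonnegative on the
diagonal, and continuous on their nonvanishing locus, which is open. -/
structure IsSymmOdd (g : Sph m × Sph m → ℝ) : Prop where
  neg_left : ∀ x y, g (-x, y) = -g (x, y)
  neg_right : ∀ x y, g (x, -y) = -g (x, y)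
  symm : ∀ x y, g (x, y) = g (y, x)
  isOpen : IsOpen {p | g p ≠ 0}
  continuousOn : ContinuousOn g {p | g p ≠ 0}
  diag_nonneg : ∀ x, 0 ≤ g (x, x)

/-- The pairs of lines on which a biodd function does not vanish. -/
def signDomain (g : Sph m × Sph m → ℝ) : Set (RP m × RP m) := RP.mk₂ m '' {p | g p ≠ 0}

namespace IsSymmOdd

variable {g : Sph m × Sph m → ℝ}

theorem of_continuous (hc : Continuous g) (hl : ∀ x y, g (-x, y) = -g (x, y))
    (hr : ∀ x y, g (x, -y) = -g (x, y)) (hs : ∀ x y, g (x, y) = g (y, x))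
    (hd : ∀ x, 0 ≤ g (x, x)) : IsSymmOdd g :=
  ⟨hl, hr, hs, isOpen_ne_fun hc continuous_const, hc.continuousOn, hd⟩

theorem mk₂_mem_signDomain_iff (hg : IsSymmOdd g) (x y : Sph m) :
    RP.mk₂ m (x, y) ∈ signDomain g ↔ g (x, y) ≠ 0 := by
  refine ⟨?_, fun h => ⟨(x, y), h, rfl⟩⟩
  rintro ⟨⟨x', y'⟩, h, hxy⟩
  have h' : g (x', y') ≠ 0 := h
  obtain ⟨hx | hx, hy | hy⟩ := RP.mk₂_eq_mk₂ hxy <;> subst hx <;> subst hy <;>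
    simpa [hg.neg_left, hg.neg_right] using h'

theorem preimage_signDomain (hg : IsSymmOdd g) :
    RP.mk₂ m ⁻¹' signDomain g = {p | g p ≠ 0} :=
  Set.ext fun p => hg.mk₂_mem_signDomain_iff p.1 p.2

theorem isOpen_signDomain (hg : IsSymmOdd g) : IsOpen (signDomain g) :=
  RP.isOpenQuotientMap_mk₂.isOpenMap _ hg.isOpen

theorem mapsTo_swap_signDomain (hg : IsSymmOdd g) :
    Set.MapsTo Prod.swap (signDomain g) (signDomain g) := by
  rintro _ ⟨⟨x, y⟩, h, rfl⟩
  have h' : g (x, y) ≠ 0 := h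
  exact ⟨(y, x), by rwa [Set.mem_ofPred_eq, ← hg.symm], rfl⟩

theorem hasEquivariantSection (hg : IsSymmOdd g) :
    HasEquivariantSection PathSp.reverse Prod.swap (doubleEval (X := RP m)) (signDomain g) := by
  refine IsSignFunction.hasEquivariantSection (g := g)
    ⟨?_, fun x y h => (hg.mk₂_mem_signDomain_iff x y).mp h, fun x y _ => hg.neg_left x y,
      fun x y _ => hg.neg_right x y, fun x y _ => hg.symm x y, fun x h =>
      (hg.diag_nonneg x).lt_of_ne' ((hg.mk₂_mem_signDomain_iff x x).mp h)⟩
  rw [hg.preimage_signDomain]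
  exact hg.continuousOn

end IsSymmOdd

/-- The equivariant sections given by finitely many biodd functions without common zeros. -/
theorem hasEquivariantSectionalCover_of_isSymmOdd {k : ℕ} (g : Fin k → Sph m × Sph m → ℝ)
    (hg : ∀ i, IsSymmOdd (g i)) (h : ∀ p, ∃ i, g i p ≠ 0) :
    HasEquivariantSectionalCover PathSp.reverse Prod.swap (doubleEval (X := RP m)) k := by
  refine ⟨fun i => signDomain (g i), fun i => ⟨(hg i).isOpen_signDomain,
    (hg i).mapsTo_swap_signDomain, (hg i).hasEquivariantSection⟩, ?_⟩
  refine Set.eq_univ_of_forall fun P => ?_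
  obtain ⟨p, rfl⟩ := RP.isOpenQuotientMap_mk₂.surjective P
  obtain ⟨i, hi⟩ := h p
  exact Set.mem_iUnion.mpr ⟨i, p, hi, rfl⟩

/-- The inner product of the lifts is symmetric and biodd, and positive near the diagonal. -/
theorem isSymmOdd_inner : IsSymmOdd fun p : Sph m × Sph m =>
    inner ℝ (p.1 : EuclideanSpace ℝ (Fin (m + 1))) (p.2 : EuclideanSpace ℝ (Fin (m + 1))) :=
  .of_continuous (by fun_prop) (fun _ _ => inner_neg_left _ _) (fun _ _ => inner_neg_right _ _)
    (fun _ _ => real_inner_comm _ _) (fun _ => real_inner_self_nonneg)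

/-! ### Open paths -/

section OpenPaths

variable {X : Type*} [TopologicalSpace X]

theorem HasEquivariantSection.image_offDiag {U : Set (OffDiag X)}
    (h : HasEquivariantSection OpenPathSp.reverse OffDiag.swap (openDoubleEval (X := X)) U) :
    HasEquivariantSection PathSp.reverse Prod.swap (doubleEval (X := X)) (Subtype.val '' U) := by
  obtain ⟨s, hs, hend, hswap⟩ := h
  have hne : ∀ u : (Subtype.val '' U : Set (X × X)), (u : X × X).1 ≠ (u : X × X).2 := by
    rintro ⟨_, v, hv, rfl⟩
    exact v.2
  have hmem : ∀ u : (Subtype.val '' U : Set (X × X)), (⟨u, hne u⟩ : OffDiag X) ∈ U := by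
    rintro ⟨_, v, hv, rfl⟩
    exact hv
  refine ⟨fun u => (s ⟨⟨u, hne u⟩, hmem u⟩).1, ?_, fun u => ?_, fun u v huv => ?_⟩
  · exact continuous_subtype_val.comp (hs.comp
      ((continuous_subtype_val.subtype_mk hne).subtype_mk hmem))
  · exact congrArg Subtype.val (hend ⟨⟨u, hne u⟩, hmem u⟩)
  · exact congrArg Subtype.val (hswap ⟨⟨u, hne u⟩, hmem u⟩ ⟨⟨v, hne v⟩, hmem v⟩ (Subtype.ext huv))

/-- Off the diagonal the endpoint condition already makes every chosen path open. -/
theorem HasEquivariantSection.preimage_offDiag {V : Set (X × X)}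
    (h : HasEquivariantSection PathSp.reverse Prod.swap (doubleEval (X := X)) V) :
    HasEquivariantSection OpenPathSp.reverse OffDiag.swap (openDoubleEval (X := X))
      (Subtype.val ⁻¹' V) := by
  obtain ⟨s, hs, hend, hswap⟩ := h
  let j : (Subtype.val ⁻¹' V : Set (OffDiag X)) → V := fun u => ⟨u.1.1, u.2⟩
  have hj : Continuous j := (continuous_subtype_val.comp continuous_subtype_val).subtype_mk _
  have hne : ∀ u, s (j u) 0 ≠ s (j u) 1 := fun u => by
    have h0 : s (j u) 0 = u.1.1.1 := congrArg Prod.fst (hend (j u))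
    have h1 : s (j u) 1 = u.1.1.2 := congrArg Prod.snd (hend (j u))
    rw [h0, h1]
    exact u.1.2
  refine ⟨fun u => ⟨s (j u), hne u⟩, (hs.comp hj).subtype_mk hne, fun u => ?_, fun u v huv => ?_⟩
  · exact Subtype.ext (hend (j u))
  · exact Subtype.ext (hswap (j u) (j v) (congrArg Subtype.val huv))

end OpenPaths

/-- The inner product of lifts is nonzero on the diagonal, so its sign domain covers what the `k +
1` off-diagonal sets miss. This makes `k + 2` sets, as required for the value `k + 1`. -/
theorem TCSigma_le_TCS : TCSigma (RP m) ≤ TCS (RP m) := by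
  by_cases htop : equivariantSecat OpenPathSp.reverse OffDiag.swap
      (openDoubleEval (X := RP m)) = ⊤
  · rw [TCS, htop, top_add]
    exact le_top
  obtain ⟨k, ⟨U, hU, hcov⟩, hk⟩ := exists_mem_of_leastNat_ne_top htop
  have hk' : equivariantSecat OpenPathSp.reverse OffDiag.swap (openDoubleEval (X := RP m)) = k := hk
  rw [TCS, hk']
  refine leastNat_le (n := k + 1) ⟨k.succ_pos, Fin.cons (signDomain fun p : Sph m × Sph m =>
    inner ℝ (p.1 : EuclideanSpace ℝ (Fin (m + 1))) (p.2 : EuclideanSpace ℝ (Fin (m + 1))))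
    (fun i => Subtype.val '' U i), ?_, ?_⟩
  · refine Fin.cases ?_ fun i => ?_
    · exact ⟨isSymmOdd_inner.isOpen_signDomain, isSymmOdd_inner.mapsTo_swap_signDomain,
        isSymmOdd_inner.hasEquivariantSection⟩
    · obtain ⟨ho, hm, hsec⟩ := hU i
      refine ⟨?_, ?_, hsec.image_offDiag⟩
      · exact (isClosed_diagonal.isOpen_compl.isOpenEmbedding_subtypeVal).isOpenMap _ ho
      · rintro _ ⟨v, hv, rfl⟩
        exact ⟨OffDiag.swap v, hm hv, rfl⟩
  · refine Set.eq_univ_of_forall fun P => Set.mem_iUnion.mpr ?_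
    by_cases hP : P.1 = P.2
    · refine ⟨0, ?_⟩
      obtain ⟨x, hx⟩ := RP.mk_surjective P.1
      have hPx : P = RP.mk₂ m (x, x) := Prod.ext hx.symm (hP.symm.trans hx.symm)
      rw [hPx, Fin.cons_zero, isSymmOdd_inner.mk₂_mem_signDomain_iff]
      simp only [inner_self_eq_one]
      exact one_ne_zero
    · obtain ⟨i, hi⟩ := Set.mem_iUnion.mp (hcov.ge (Set.mem_univ (⟨P, hP⟩ : OffDiag (RP m))))
      exact ⟨i.succ, ⟨P, hP⟩, hi, rfl⟩

/-! ### Embeddings -/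

theorem RP.nontrivial (hm : 1 ≤ m) : Nontrivial (RP m) := by
  have : Nontrivial (Fin (m + 1)) := Fin.nontrivial_iff_two_le.mpr (by omega)
  obtain ⟨i, j, hij⟩ := exists_pair_ne (Fin (m + 1))
  let e : Fin (m + 1) → Sph m := fun k => ⟨EuclideanSpace.single k 1, by simp⟩
  refine ⟨RP.mk m (e i), RP.mk m (e j), fun h => ?_⟩
  rcases RP.mk_eq_mk_iff.mp h with h | h <;>
  · have h' := congrArg (fun x : Sph m => (x : EuclideanSpace ℝ (Fin (m + 1))) i) h
    simp [e, hij] at h'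

/-- The pairs of points of the sphere which span different lines. -/
def independentPairs (m : ℕ) : Set (Sph m × Sph m) :=
  {p | (p.1 : EuclideanSpace ℝ (Fin (m + 1))) + p.2 ≠ 0 ∧
    (p.1 : EuclideanSpace ℝ (Fin (m + 1))) - p.2 ≠ 0}

theorem isOpen_independentPairs : IsOpen (independentPairs m) :=
  (isOpen_ne_fun (by fun_prop) continuous_const).inter
    (isOpen_ne_fun (by fun_prop) continuous_const)

theorem mem_independentPairs {x y : Sph m} (h : RP.mk m x ≠ RP.mk m y) :
    (x, y) ∈ independentPairs m :=
  ⟨fun h' => h (RP.mk_eq_mk_iff.mpr (Or.inr (Subtype.ext (eq_neg_of_add_eq_zero_left h')))),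
    fun h' => h (RP.mk_eq_mk_iff.mpr (Or.inl (Subtype.ext (sub_eq_zero.mp h'))))⟩

open Classical in
/-- The difference of the values of a function at the two bisectors of a pair of lines. -/
noncomputable def bisectorDiff (f : RP m → ℝ) (p : Sph m × Sph m) : ℝ :=
  if h : p ∈ independentPairs m then f (RP.ofVec ⟨_, h.1⟩) - f (RP.ofVec ⟨_, h.2⟩) else 0

theorem bisectorDiff_eq {f : RP m → ℝ} {p : Sph m × Sph m} (h : p ∈ independentPairs m) :
    bisectorDiff f p = f (RP.ofVec ⟨_, h.1⟩) - f (RP.ofVec ⟨_, h.2⟩) := dif_pos h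

theorem bisectorDiff_eq_zero {f : RP m → ℝ} {p : Sph m × Sph m} (h : p ∉ independentPairs m) :
    bisectorDiff f p = 0 := dif_neg h

theorem continuousOn_bisectorDiff {f : RP m → ℝ} (hf : Continuous f) :
    ContinuousOn (bisectorDiff f) (independentPairs m) := by
  rw [continuousOn_iff_continuous_domRestrict]
  have : (independentPairs m).domRestrict (bisectorDiff f) = fun p : independentPairs m =>
      f (RP.ofVec ⟨_, p.2.1⟩) - f (RP.ofVec ⟨_, p.2.2⟩) := funext fun p => bisectorDiff_eq p.2
  rw [this]
  refine (hf.comp (RP.continuous_ofVec.comp (Continuous.subtype_mk ?_ _))).sub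
    (hf.comp (RP.continuous_ofVec.comp (Continuous.subtype_mk ?_ _))) <;> fun_prop

/-- Replacing `y` by `-y` interchanges the bisectors `x + y` and `x - y`. -/
theorem bisectorDiff_neg_right (f : RP m → ℝ) (x y : Sph m) :
    bisectorDiff f (x, -y) = -bisectorDiff f (x, y) := by
  by_cases h : (x, y) ∈ independentPairs m
  · have h' : (x, -y) ∈ independentPairs m := by simpa [independentPairs, ← sub_eq_add_neg] using h.symm
    rw [bisectorDiff_eq h, bisectorDiff_eq h', neg_sub]
    congr 2
    exact RP.ofVec_eq_ofVec _ _ (c := 1) (by simp)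
  · have h' : (x, -y) ∉ independentPairs m := fun h' => h (by
      simpa [independentPairs, ← sub_eq_add_neg] using h'.symm)
    rw [bisectorDiff_eq_zero h, bisectorDiff_eq_zero h', neg_zero]

theorem bisectorDiff_symm (f : RP m → ℝ) (x y : Sph m) :
    bisectorDiff f (x, y) = bisectorDiff f (y, x) := by
  have hmem : ∀ {x y : Sph m}, (x, y) ∈ independentPairs m → (y, x) ∈ independentPairs m := by
    rintro x y ⟨h1, h2⟩
    exact ⟨fun h => h1 ((add_comm _ _).trans h), fun h => h2 (sub_eq_zero.mpr (sub_eq_zero.mp h).symm)⟩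
  by_cases h : (x, y) ∈ independentPairs m
  · rw [bisectorDiff_eq h, bisectorDiff_eq (hmem h)]
    congr 2
    · exact RP.ofVec_eq_ofVec _ _ (c := 1) (by rw [one_smul]; exact add_comm _ _)
    · exact RP.ofVec_eq_ofVec _ _ (c := -1) (by rw [neg_one_smul]; exact (neg_sub _ _).symm)
  · rw [bisectorDiff_eq_zero h, bisectorDiff_eq_zero fun h' => h (hmem h')]

/-- Continuity may fail where the lines coincide, but there the default value is `0`, so the
nonvanishing locus stays inside the open set of independent pairs. -/
theorem isSymmOdd_bisectorDiff {f : RP m → ℝ} (hf : Continuous f) : IsSymmOdd (bisectorDiff f) := by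
  have hsub : {p | bisectorDiff f p ≠ 0} ⊆ independentPairs m := fun p hp => by
    by_contra h
    exact hp (bisectorDiff_eq_zero h)
  have hc := continuousOn_bisectorDiff hf
  refine ⟨fun x y => ?_, bisectorDiff_neg_right f, bisectorDiff_symm f, ?_, hc.mono hsub,
    fun x => le_of_eq ?_⟩
  · rw [bisectorDiff_symm, bisectorDiff_neg_right, bisectorDiff_symm]
  · have := hc.isOpen_inter_preimage isOpen_independentPairs (isOpen_ne (x := (0 : ℝ)))
    rwa [show independentPairs m ∩ bisectorDiff f ⁻¹' {y | y ≠ 0} = {p | bisectorDiff f p ≠ 0} from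
      Set.inter_eq_right.mpr hsub] at this
  · exact (bisectorDiff_eq_zero fun h => h.2 (sub_self _)).symm

/-- The bisectors are orthogonal because `x` and `y` have equal norm. -/
theorem ofVec_add_ne_ofVec_sub {p : Sph m × Sph m} (h : p ∈ independentPairs m) :
    RP.ofVec ⟨_, h.1⟩ ≠ RP.ofVec ⟨_, h.2⟩ := by
  intro heq
  obtain ⟨c, hc⟩ := RP.exists_smul_eq_of_ofVec_eq _ _ heq
  refine h.1 (inner_self_eq_zero (𝕜 := ℝ).mp ?_)
  conv_lhs => rw [hc]
  rw [real_inner_smul_left, ← hc, real_inner_comm, real_inner_add_sub_eq_zero_iff _ _ |>.mpr, mul_zero]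
  rw [Sph.norm_coe, Sph.norm_coe]

/-- If all coordinates of `f` agreed on the two bisectors, injectivity would identify these distinct
lines. Hence the `n` sign domains cover the complement of the diagonal. -/
theorem TCS_le_Emb (hm : 1 ≤ m) : TCS (RP m) ≤ Emb m := by
  refine le_iInf₂ fun n ⟨f, hf⟩ => ?_
  have := RP.nontrivial hm
  -- The reduced count uses `k + 1` sets, so `n = 0` must be excluded; it is, since `ℝP^m` has two
  -- points.
  obtain ⟨k, rfl⟩ : ∃ k, n = k + 1 := by
    refine Nat.exists_eq_succ_of_ne_zero ?_
    rintro rfl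
    obtain ⟨a, b, hab⟩ := exists_pair_ne (RP m)
    exact hab (hf.injective (Subsingleton.elim _ _))
  have hfi : ∀ i, Continuous fun A => f A i := fun i =>
    (EuclideanSpace.proj (𝕜 := ℝ) i).continuous.comp hf.continuous
  have hg := fun i => isSymmOdd_bisectorDiff (hfi i)
  have key : HasEquivariantSectionalCover OpenPathSp.reverse OffDiag.swap
      (openDoubleEval (X := RP m)) (k + 1) := by
    refine ⟨fun i => Subtype.val ⁻¹' signDomain (bisectorDiff fun A => f A i),
      fun i => ⟨?_, ?_, ?_⟩, ?_⟩
    · exact (hg i).isOpen_signDomain.preimage continuous_subtype_val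
    · exact fun P hP => (hg i).mapsTo_swap_signDomain hP
    · exact (hg i).hasEquivariantSection.preimage_offDiag
    · refine Set.eq_univ_of_forall fun P => Set.mem_iUnion.mpr ?_
      obtain ⟨⟨A, B⟩, hAB⟩ := P
      obtain ⟨x, rfl⟩ := RP.mk_surjective A
      obtain ⟨y, rfl⟩ := RP.mk_surjective B
      have hxy := mem_independentPairs hAB
      by_contra! hall
      refine ofVec_add_ne_ofVec_sub hxy (hf.injective (PiLp.ext fun i => ?_))
      have hi : bisectorDiff (fun A => f A i) (x, y) = 0 := by
        by_contra hi
        exact hall i (((hg i).mk₂_mem_signDomain_iff x y).mpr hi)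
      rw [bisectorDiff_eq hxy] at hi
      exact sub_eq_zero.mp hi
  rw [TCS, Nat.cast_succ]
  exact add_le_add (leastNat_le key) le_rfl

theorem Emb_le_smoothEmb : Emb m ≤ smoothEmb m :=
  leastNat_mono fun _ ⟨f, hf, _⟩ => ⟨f, hf⟩

/-! ### A smooth embedding -/

/-- The quadratic map `x ↦ (x_i x_j)`. -/
noncomputable def veronese (m : ℕ) (v : EuclideanSpace ℝ (Fin (m + 1))) :
    EuclideanSpace ℝ (Fin ((m + 1) * (m + 1))) :=
  WithLp.toLp 2 fun k => v (finProdFinEquiv.symm k).1 * v (finProdFinEquiv.symm k).2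

theorem veronese_apply (v : EuclideanSpace ℝ (Fin (m + 1))) (i j : Fin (m + 1)) :
    veronese m v (finProdFinEquiv (i, j)) = v i * v j := by
  rw [veronese, PiLp.toLp_apply, Equiv.symm_apply_apply]

theorem contDiff_veronese : ContDiff ℝ ∞ (veronese m) :=
  contDiff_euclidean.mpr fun _ =>
    (contDiff_euclidean.mp contDiff_id _).mul (contDiff_euclidean.mp contDiff_id _)

theorem veronese_neg (v : EuclideanSpace ℝ (Fin (m + 1))) : veronese m (-v) = veronese m v := by
  simp [veronese]

/-- The derivative of the quadratic map at a unit vector is injective on its complement. -/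
theorem eq_zero_of_fderiv_veronese_eq_zero {x v : EuclideanSpace ℝ (Fin (m + 1))} (hx : ‖x‖ = 1)
    (hv : inner ℝ x v = 0) (h : fderiv ℝ (veronese m) x v = 0) : v = 0 := by
  have hd : HasFDerivAt (veronese m) (fderiv ℝ (veronese m) x) x :=
    (contDiff_veronese.differentiable (by simp)).differentiableAt.hasFDerivAt
  have hij : ∀ i j, x i * v j + x j * v i = 0 := fun i j => by
    have h1 := (EuclideanSpace.proj (𝕜 := ℝ) (finProdFinEquiv (i, j))).hasFDerivAt.comp x hd
    have hp : ∀ k : Fin (m + 1), HasFDerivAt (fun y : EuclideanSpace ℝ (Fin (m + 1)) => y k)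
        (EuclideanSpace.proj (𝕜 := ℝ) k : EuclideanSpace ℝ (Fin (m + 1)) →L[ℝ] ℝ) x :=
      fun k => (EuclideanSpace.proj (𝕜 := ℝ) k).hasFDerivAt
    have h2 := (hp i).mul (hp j)
    have h3 := h1.unique (h2.congr_of_eventuallyEq
      (Filter.Eventually.of_forall fun y => veronese_apply y i j))
    have h4 := DFunLike.congr_fun h3 v
    simpa [h] using h4.symm
  have hsum : ∑ i, x i * x i = 1 := by
    rw [EuclideanSpace.norm_eq, Real.sqrt_eq_one] at hx
    simpa [sq] using hx
  have hin : ∑ i, x i * v i = 0 := by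
    rw [PiLp.inner_apply] at hv
    simpa [mul_comm] using hv
  ext j
  -- Multiply the relation `hij` by `x i` and sum over `i`.
  calc v j = (∑ i, x i * x i) * v j + x j * ∑ i, x i * v i := by rw [hsum, hin]; ring
    _ = ∑ i, x i * (x i * v j + x j * v i) := by
      rw [Finset.sum_mul, Finset.mul_sum, ← Finset.sum_add_distrib]
      exact Finset.sum_congr rfl fun i _ => by ring
    _ = 0 := Finset.sum_eq_zero fun i _ => by rw [hij, mul_zero]

/-- The embedding of `ℝP^m` induced by the quadratic map. -/
noncomputable def veroneseRP (m : ℕ) (A : RP m) : EuclideanSpace ℝ (Fin ((m + 1) * (m + 1))) :=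
  Quotient.lift (s := antipodalSetoid m)
    (fun x : Sph m => veronese m (x : EuclideanSpace ℝ (Fin (m + 1)))) (by
      rintro x y (rfl | rfl)
      · rfl
      · exact veronese_neg _) A

theorem veroneseRP_mk (x : Sph m) : veroneseRP m (RP.mk m x) = veronese m x := rfl

/-- The square of a nonzero coordinate determines it up to sign, and its products with the others
then determine the vector up to that sign. -/
theorem veroneseRP_injective : Function.Injective (veroneseRP m) := by
  intro A B h
  obtain ⟨x, rfl⟩ := RP.mk_surjective A
  obtain ⟨y, rfl⟩ := RP.mk_surjective B
  rw [veroneseRP_mk, veroneseRP_mk] at h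
  have hij : ∀ i j, x.1 i * x.1 j = y.1 i * y.1 j := fun i j => by
    rw [← veronese_apply, h, veronese_apply]
  obtain ⟨k, hk⟩ : ∃ k, x.1 k ≠ 0 := by
    by_contra! hall
    exact x.coe_ne_zero (PiLp.ext hall)
  rcases mul_self_eq_mul_self_iff.mp (hij k k) with hs | hs
  · refine RP.mk_eq_mk_iff.mpr (Or.inl (Subtype.ext (PiLp.ext fun j => ?_)))
    have := hij k j
    rw [← hs] at this
    exact mul_left_cancel₀ hk this
  · refine RP.mk_eq_mk_iff.mpr (Or.inr (Subtype.ext (PiLp.ext fun j => ?_)))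
    have := hij k j
    rw [← neg_eq_iff_eq_neg.mpr hs, neg_mul, ← mul_neg] at this
    exact mul_left_cancel₀ hk this

theorem isEmbedding_veroneseRP : Topology.IsEmbedding (veroneseRP m) := by
  have hc : Continuous (veroneseRP m) := RP.isOpenQuotientMap_mk.continuous_comp_iff.mp
    (contDiff_veronese.continuous.comp continuous_subtype_val)
  exact (hc.isClosedEmbedding veroneseRP_injective).isEmbedding

/-- The differential factors through the inclusion of the sphere, whose tangent space at `x` is the
orthogonal complement of `x`, where the quadratic map is immersive. -/
theorem smoothEmb_lt_top : smoothEmb m < ⊤ := by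
  have : Fact (Module.finrank ℝ (EuclideanSpace ℝ (Fin (m + 1))) = m + 1) :=
    ⟨finrank_euclideanSpace_fin⟩
  refine lt_of_le_of_lt (leastNat_le (n := (m + 1) * (m + 1))
    ⟨veroneseRP m, isEmbedding_veroneseRP, ?_, fun x => ?_⟩) (ENat.natCast_lt_top _)
  · exact contDiff_veronese.contMDiff.comp contMDiff_coe_sphere
  · have hcoe : MDifferentiableAt (𝓡 m) 𝓘(ℝ, EuclideanSpace ℝ (Fin (m + 1)))
        ((↑) : Sph m → EuclideanSpace ℝ (Fin (m + 1))) x :=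
      (contMDiff_coe_sphere (m := ∞)).mdifferentiableAt (by simp)
    have hver : MDifferentiableAt 𝓘(ℝ, EuclideanSpace ℝ (Fin (m + 1)))
        (𝓡 ((m + 1) * (m + 1))) (veronese m) (x : EuclideanSpace ℝ (Fin (m + 1))) :=
      (contDiff_veronese.contMDiff).mdifferentiableAt (by simp)
    change Function.Injective (mfderiv (𝓡 m) (𝓡 ((m + 1) * (m + 1)))
      (veronese m ∘ ((↑) : Sph m → EuclideanSpace ℝ (Fin (m + 1)))) x)
    rw [mfderiv_comp x hver hcoe, mfderiv_eq_fderiv]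
    refine (injective_iff_map_eq_zero _).mpr fun v hv => ?_
    refine (injective_iff_map_eq_zero _).mp (mfderiv_coe_sphere_injective x) v ?_
    refine eq_zero_of_fderiv_veronese_eq_zero x.norm_coe ?_ hv
    have hr := range_mfderiv_coe_sphere (n := m) x
    exact (Submodule.mem_orthogonal_singleton_iff_inner_right).mp (hr ▸ ⟨v, rfl⟩)

/-! ### Biequivariant maps and the symmetrized topological complexity -/

/-- A codimension one subspace is the kernel of an inner product which is positive on a given
connected image of the sphere avoiding it. -/
theorem exists_inner_pos (hm : 1 ≤ m) {n : ℕ} (H : Submodule ℝ (EuclideanSpace ℝ (Fin (n + 1))))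
    (hH : Module.finrank ℝ H = n) (f : Sph m → EuclideanSpace ℝ (Fin (n + 1))) (hf : Continuous f)
    (hfH : ∀ x, f x ∉ H) : ∃ u : EuclideanSpace ℝ (Fin (n + 1)),
      (∀ v, inner ℝ u v = 0 → v ∈ H) ∧ ∀ x, 0 < inner ℝ u (f x) := by
  have hperp : Module.finrank ℝ Hᗮ = 1 := by
    have := Submodule.finrank_add_finrank_orthogonal H
    rw [hH, finrank_euclideanSpace_fin] at this
    omega
  obtain ⟨u, -, hu⟩ := finrank_eq_one_iff'.mp hperp
  have hmem : ∀ v, inner ℝ (u : EuclideanSpace ℝ (Fin (n + 1))) v = 0 → v ∈ H := fun v hv => by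
    rw [← Submodule.orthogonal_orthogonal H, Submodule.mem_orthogonal]
    intro w hw
    obtain ⟨c, hc⟩ := hu ⟨w, hw⟩
    have hc' : c • (u : EuclideanSpace ℝ (Fin (n + 1))) = w := congrArg Subtype.val hc
    rw [← hc', real_inner_smul_left, hv, mul_zero]
  have hconn : PreconnectedSpace (Sph m) := by
    refine isPreconnected_iff_preconnectedSpace.mp (isPreconnected_sphere ?_ _ _)
    rw [← Module.finrank_eq_rank, finrank_euclideanSpace_fin]
    exact_mod_cast Nat.lt_succ_of_le hm
  have hc : Continuous fun x => inner ℝ (u : EuclideanSpace ℝ (Fin (n + 1))) (f x) := by fun_prop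
  have hne : ∀ x, inner ℝ (u : EuclideanSpace ℝ (Fin (n + 1))) (f x) ≠ 0 := fun x h =>
    hfH x (hmem _ h)
  by_cases hpos : ∀ x, 0 < inner ℝ (u : EuclideanSpace ℝ (Fin (n + 1))) (f x)
  · exact ⟨u, hmem, hpos⟩
  -- The functional has no zero on the connected image, hence constant sign; if that sign is
  -- negative, use `-u`.
  · push Not at hpos
    obtain ⟨x, hx⟩ := hpos
    refine ⟨-u, fun v hv => hmem v ?_, fun y => ?_⟩
    · rwa [inner_neg_left, neg_eq_zero] at hv
    · rw [inner_neg_left, neg_pos]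
      by_contra! hy
      obtain ⟨z, hz⟩ := mem_range_of_exists_le_of_exists_ge hc ⟨x, hx⟩ ⟨y, hy⟩
      exact hne z hz

/-- The normal functional of `H` is positive on the diagonal, but the coordinates along `H` have no
controlled sign there. The factor `1 - q ^ 2` makes them vanish on the diagonal and kills nothing
elsewhere, being zero only when the lines coincide, where the first function is nonzero. -/
theorem TCSigma_le_sbBar (hm : 1 ≤ m) : TCSigma (RP m) ≤ sbBar m := by
  refine leastNat_mono fun n ⟨hn, b, hb, H, hH, hbH⟩ => ⟨hn, ?_⟩
  have hbc := hb.continuous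
  obtain ⟨u, hu, hpos⟩ := exists_inner_pos hm H hH
    (fun x : Sph m => (b (x, x) : EuclideanSpace ℝ (Fin (n + 1)))) (by fun_prop) hbH
  let B : Sph m × Sph m → EuclideanSpace ℝ (Fin (n + 1)) := fun p => b p
  have hBc : Continuous B := by fun_prop
  have hBl : ∀ x y, B (-x, y) = -B (x, y) := fun x y => congrArg Subtype.val (hb.neg_left x y)
  have hBr : ∀ x y, B (x, -y) = -B (x, y) := fun x y => congrArg Subtype.val (hb.neg_right x y)
  have hBs : ∀ x y, B (x, y) = B (y, x) := fun x y => congrArg Subtype.val (hb.symm x y)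
  let e := (stdOrthonormalBasis ℝ H).reindex (finCongr hH)
  let q : Sph m × Sph m → ℝ := fun p =>
    inner ℝ (p.1 : EuclideanSpace ℝ (Fin (m + 1))) (p.2 : EuclideanSpace ℝ (Fin (m + 1)))
  have hq : IsSymmOdd q := isSymmOdd_inner
  have hqc : Continuous q := by fun_prop
  let g : Fin (n + 1) → Sph m × Sph m → ℝ := Fin.cons (fun p => inner ℝ u (B p))
    fun i p => inner ℝ (e i : EuclideanSpace ℝ (Fin (n + 1))) (B p) * (1 - q p ^ 2)
  have hg0 : ∀ p, g 0 p = inner ℝ u (B p) := fun _ => rfl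
  have hgs : ∀ i p, g (Fin.succ i) p =
    inner ℝ (e i : EuclideanSpace ℝ (Fin (n + 1))) (B p) * (1 - q p ^ 2) := fun _ _ => rfl
  refine hasEquivariantSectionalCover_of_isSymmOdd g (fun i => ?_) fun p => ?_
  · induction i using Fin.cases with
    | zero =>
      refine .of_continuous ?_ (fun x y => ?_) (fun x y => ?_) (fun x y => ?_) fun x => (hpos x).le
      · change Continuous fun p => inner ℝ u (B p)
        fun_prop
      · rw [hg0, hg0, hBl, inner_neg_right]
      · rw [hg0, hg0, hBr, inner_neg_right]
      · rw [hg0, hg0, hBs]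
    | succ i =>
      refine .of_continuous ?_ (fun x y => ?_) (fun x y => ?_) (fun x y => ?_) fun x => ?_
      · change Continuous fun p =>
          inner ℝ (e i : EuclideanSpace ℝ (Fin (n + 1))) (B p) * (1 - q p ^ 2)
        fun_prop
      · rw [hgs, hgs, hBl, hq.neg_left, inner_neg_right, neg_sq, neg_mul]
      · rw [hgs, hgs, hBr, hq.neg_right, inner_neg_right, neg_sq, neg_mul]
      · rw [hgs, hgs, hBs, hq.symm]
      · have hqx : q (x, x) = 1 := inner_self_eq_one x
        rw [hgs, hqx]
        norm_num
  · by_contra! hall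
    have hH0 : B p ∈ H := hu _ (hall 0)
    obtain ⟨x, y⟩ := p
    have hxy : q (x, y) ^ 2 ≠ 1 := by
      intro hq1
      have h0 := hall 0
      rw [hg0] at h0
      rw [sq] at hq1
      rcases mul_self_eq_one_iff.mp hq1 with h | h
      · obtain rfl : x = y := Subtype.ext
          ((inner_eq_one_iff_of_norm_eq_one x.norm_coe y.norm_coe).mp h)
        exact (hpos x).ne' h0
      · have : x = -y := by
          refine Subtype.ext ((inner_eq_one_iff_of_norm_eq_one (𝕜 := ℝ) x.norm_coe
            (-y).norm_coe).mp ?_)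
          exact (hq.neg_right x y).trans (by rw [h, neg_neg])
        subst this
        rw [hBl, inner_neg_right, neg_eq_zero] at h0
        exact (hpos y).ne' h0
    have hz : (⟨B (x, y), hH0⟩ : H) = 0 := by
      refine e.repr.injective (PiLp.ext fun i => ?_)
      have hi := hall i.succ
      rw [hgs] at hi
      rw [e.repr_apply_apply, map_zero]
      exact (mul_eq_zero.mp hi).resolve_right (sub_ne_zero.mpr hxy.symm)
    exact (b (x, y)).coe_ne_zero (congrArg Subtype.val hz)

/-- The cutoff `φ` lets the sign function be extended by zero outside `U`. As `φ` need not be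
invariant under the switch, the product is symmetrized; no cancellation occurs since `φ` is
nonnegative and `g` symmetric. -/
theorem exists_coordinate {U : Set (RP m × RP m)} (hU : IsOpen U)
    (hUs : Set.MapsTo Prod.swap U U)
    (h : HasEquivariantSection PathSp.reverse Prod.swap (doubleEval (X := RP m)) U)
    {φ : RP m × RP m → ℝ} (hφ : Continuous φ) (hφ0 : ∀ P, 0 ≤ φ P) (hφU : tsupport φ ⊆ U) :
    ∃ c : Sph m × Sph m → ℝ, Continuous c ∧ (∀ x y, c (-x, y) = -c (x, y)) ∧
      (∀ x y, c (x, -y) = -c (x, y)) ∧ (∀ x y, c (x, y) = c (y, x)) ∧ (∀ x, 0 ≤ c (x, x)) ∧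
      ∀ p, φ (RP.mk₂ m p) ≠ 0 → c p ≠ 0 := by
  obtain ⟨g, hg⟩ := h.exists_isSignFunction hUs
  have hmk : Continuous (RP.mk₂ m) := RP.isOpenQuotientMap_mk₂.continuous
  let ψ : RP m × RP m → ℝ := fun P => φ P + φ P.swap
  have hφmem : ∀ P, P ∉ U → φ P = 0 := fun P hP => by
    by_contra h0
    exact hP (hφU (subset_tsupport _ h0))
  have hψmem : ∀ P, P ∉ U → ψ P = 0 := fun P hP => by
    have hP' : P.swap ∉ U := fun h0 => hP (by simpa using hUs h0)
    simp only [ψ, hφmem P hP, hφmem _ hP', add_zero]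
  let d : Sph m × Sph m → ℝ := fun p => φ (RP.mk₂ m p) * g p
  have hd : Continuous d := by
    refine continuous_iff_continuousAt.mpr fun p => ?_
    by_cases hp : RP.mk₂ m p ∈ U
    · exact (hφ.comp hmk).continuousAt.mul
        (hg.continuousOn.continuousAt ((hU.preimage hmk).mem_nhds hp))
    · have hp' : RP.mk₂ m p ∈ (tsupport φ)ᶜ := fun h0 => hp (hφU h0)
      have hev : d =ᶠ[nhds p] fun _ => 0 := by
        filter_upwards [((isClosed_tsupport φ).isOpen_compl.preimage hmk).mem_nhds hp'] with a ha
        have : φ (RP.mk₂ m a) = 0 := image_eq_zero_of_notMem_tsupport ha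
        simp only [d, this, zero_mul]
      exact continuousAt_const.congr hev.symm
  have hc : ∀ x y, d (x, y) + d (y, x) = ψ (RP.mk₂ m (x, y)) * g (x, y) := fun x y => by
    by_cases hp : RP.mk₂ m (x, y) ∈ U
    · simp only [d, ψ, RP.mk₂_swap x y, hg.symm x y hp]
      ring
    · have hp' : RP.mk₂ m (y, x) ∉ U := fun h0 => hp (hUs h0)
      simp only [d, hψmem _ hp, hφmem _ hp, hφmem _ hp', zero_mul, add_zero]
  refine ⟨fun p => d p + d p.swap, hd.add (hd.comp continuous_swap), fun x y => ?_, fun x y => ?_,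
    fun x y => add_comm _ _, fun x => ?_, ?_⟩
  · simp only [Prod.swap_prod_mk]
    rw [hc, hc, RP.mk₂_neg_left]
    by_cases hp : RP.mk₂ m (x, y) ∈ U
    · rw [hg.neg_left x y hp, mul_neg]
    · rw [hψmem _ hp, zero_mul, zero_mul, neg_zero]
  · simp only [Prod.swap_prod_mk]
    rw [hc, hc, RP.mk₂_neg_right]
    by_cases hp : RP.mk₂ m (x, y) ∈ U
    · rw [hg.neg_right x y hp, mul_neg]
    · rw [hψmem _ hp, zero_mul, zero_mul, neg_zero]
  · simp only [Prod.swap_prod_mk]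
    rw [hc]
    by_cases hp : RP.mk₂ m (x, x) ∈ U
    · exact mul_nonneg (add_nonneg (hφ0 _) (hφ0 _)) (hg.diag_pos x hp).le
    · rw [hψmem _ hp, zero_mul]
  · rintro ⟨x, y⟩ h0
    simp only [Prod.swap_prod_mk]
    rw [hc]
    have hp : RP.mk₂ m (x, y) ∈ U := by
      by_contra hp
      exact h0 (hφmem _ hp)
    exact mul_ne_zero (add_pos_of_pos_of_nonneg ((hφ0 _).lt_of_ne' h0) (hφ0 _)).ne'
      (hg.ne_zero x y hp)

/-- Normalization of a nowhere vanishing map to Euclidean space. -/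
theorem exists_isSymmBiequivariant {n : ℕ} {B : Sph m × Sph m → EuclideanSpace ℝ (Fin (n + 1))}
    (hB : Continuous B) (hl : ∀ x y, B (-x, y) = -B (x, y)) (hr : ∀ x y, B (x, -y) = -B (x, y))
    (hs : ∀ x y, B (x, y) = B (y, x)) (h0 : ∀ p, B p ≠ 0) :
    ∃ b : Sph m × Sph m → Sph n, IsSymmBiequivariant b ∧
      ∀ p, (b p : EuclideanSpace ℝ (Fin (n + 1))) = ‖B p‖⁻¹ • B p := by
  refine ⟨fun p => ⟨‖B p‖⁻¹ • B p, by simp [norm_smul, h0 p]⟩, ⟨?_, fun x y => ?_, fun x y => ?_,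
    fun x y => ?_⟩, fun _ => rfl⟩
  · exact ((hB.norm.inv₀ fun p => norm_ne_zero_iff.mpr (h0 p)).smul hB).subtype_mk _
  · refine Subtype.ext ?_
    change ‖B (-x, y)‖⁻¹ • B (-x, y) = -(‖B (x, y)‖⁻¹ • B (x, y))
    rw [hl, norm_neg, smul_neg]
  · refine Subtype.ext ?_
    change ‖B (x, -y)‖⁻¹ • B (x, -y) = -(‖B (x, y)‖⁻¹ • B (x, y))
    rw [hr, norm_neg, smul_neg]
  · refine Subtype.ext ?_
    change ‖B (x, y)‖⁻¹ • B (x, y) = ‖B (y, x)‖⁻¹ • B (y, x)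
    rw [hs]

/-- A partition of unity subordinate to the cover turns its sets into coordinates without common
zero. -/
theorem sbBar_le_TCSigma : sbBar m ≤ TCSigma (RP m) := by
  refine leastNat_mono fun n ⟨hn, U, hU, hcov⟩ => ⟨hn, ?_⟩
  obtain ⟨φ, hφ⟩ := PartitionOfUnity.exists_isSubordinate isClosed_univ U (fun i => (hU i).1)
    hcov.ge
  choose c hc hl hr hs hd hne using fun i => exists_coordinate (hU i).1 (hU i).2.1 (hU i).2.2
    (φ i).continuous (φ.nonneg i) (hφ i)
  have hex : ∀ p, ∃ i, c i p ≠ 0 := fun p => by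
    by_contra! hall
    have h1 := φ.sum_eq_one (Set.mem_univ (RP.mk₂ m p))
    have h0 : ∀ i, φ i (RP.mk₂ m p) = 0 := fun i => by
      by_contra h
      exact hne i p h (hall i)
    simp [h0] at h1
  let B : Sph m × Sph m → EuclideanSpace ℝ (Fin (n + 1)) := fun p => WithLp.toLp 2 fun i => c i p
  have hBi : ∀ p i, B p i = c i p := fun _ _ => rfl
  have h0 : ∀ p, B p ≠ 0 := fun p h => by
    obtain ⟨i, hi⟩ := hex p
    exact hi (by rw [← hBi, h]; rfl)
  obtain ⟨b, hb, hbB⟩ := exists_isSymmBiequivariant (B := B)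
    ((PiLp.continuous_toLp 2 _).comp (continuous_pi hc))
    (fun x y => PiLp.ext fun i => hl i x y) (fun x y => PiLp.ext fun i => hr i x y)
    (fun x y => PiLp.ext fun i => hs i x y) h0
  -- On the diagonal all coordinates are nonnegative and not all zero, so their sum is positive; the
  -- hyperplane of vectors with coordinate sum zero is avoided.
  let w : EuclideanSpace ℝ (Fin (n + 1)) := WithLp.toLp 2 fun _ => 1
  have hw : w ≠ 0 := fun h => one_ne_zero (congrArg (fun v : EuclideanSpace ℝ (Fin (n + 1)) => v 0) h)
  have hfact : Fact (Module.finrank ℝ (EuclideanSpace ℝ (Fin (n + 1))) = n + 1) :=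
    ⟨finrank_euclideanSpace_fin⟩
  refine ⟨b, hb, (ℝ ∙ w)ᗮ, Submodule.finrank_orthogonal_span_singleton hw, fun x hx => ?_⟩
  rw [Submodule.mem_orthogonal_singleton_iff_inner_right, hbB, real_inner_smul_right,
    mul_eq_zero, inv_eq_zero, norm_eq_zero, or_iff_right (h0 _), PiLp.inner_apply] at hx
  have hx' : ∑ i, c i (x, x) = 0 := by simpa [w, hBi] using hx
  obtain ⟨i, hi⟩ := hex (x, x)
  exact hi ((Finset.sum_eq_zero_iff_of_nonneg fun i _ => hd i x).mp hx' i (Finset.mem_univ i))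

theorem sb_le_sbBar : sb m ≤ sbBar m :=
  leastNat_mono fun _ ⟨hn, b, hb, _⟩ => ⟨hn, b, hb⟩

end SymmetricTC

theorem mainTheorem1 (m : ℕ) (hm : 1 ≤ m) :
    SymmetricTC.sb m ≤ SymmetricTC.sbBar m ∧
    SymmetricTC.sbBar m = SymmetricTC.TCSigma (SymmetricTC.RP m) ∧
    SymmetricTC.TCSigma (SymmetricTC.RP m) ≤ SymmetricTC.TCS (SymmetricTC.RP m) ∧
    SymmetricTC.TCS (SymmetricTC.RP m) ≤ SymmetricTC.Emb m ∧
    SymmetricTC.Emb m ≤ SymmetricTC.smoothEmb m ∧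
    SymmetricTC.smoothEmb m < ⊤ :=
  ⟨SymmetricTC.sb_le_sbBar,
    le_antisymm SymmetricTC.sbBar_le_TCSigma (SymmetricTC.TCSigma_le_sbBar hm),
    SymmetricTC.TCSigma_le_TCS, SymmetricTC.TCS_le_Emb hm, SymmetricTC.Emb_le_smoothEmb,
    SymmetricTC.smoothEmb_lt_top⟩
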